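/- Let $G$ be a connected (finite-dimensional, real, smooth) Lie group whose Lie algebra $\mathfrak g$ is semisimple, i.e. has zero solvable radical. Then there is no left invariant non-Riemannian $(\alpha,\beta)$-metric of the form $F=\frac{(\alpha+\beta)^2}{\alpha}$ on $G$ whose Chern connection coincides with the Levi-Civita connection of the Riemannian metric inducing $\alpha$. Explicitly: let $g$ be a left invariant Riemannian metric on $G$, let $\tilde X$ be a left invariant vector field on $G$ with $g(\tilde X,\tilde X)<1$, and let $$F(x,y)=\frac{\left(\sqrt{g_x(y,y)}+g_x(\tilde X(x),y)\right)^2}{\sqrt{g_x(y,y)}}\quad (y\in T_xG\setminus\{0\}),\qquad F(x,0)=0,$$ be the Finsler metric arising from $g$ and $\tilde X$. If the Chern connection of $F$ coincides with the Levi-Civita connection $\nabla$ of $g$, then $F$ is Riemannian, i.e. there is a smooth Riemannian metric $h$ on $G$ with $F(x,y)=\sqrt{h_x(y,y)}$ for all $x\in G$, $y\in T_xG$. Here the Chern connection of $F$ is the linear connection $D$ on the pullback of $TG$ to the slit tangent bundle $TG\setminus 0$ (a family of covariant derivatives $D^{y}$ indexed by nonzero reference vectors $y$, written $D^V$ along a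 nowhere zero local vector field $V$) which is torsion-free, $D^V_XY-D^V_YX=[X,Y]$, and almost metric-compatible, $$W\bigl(g_V(X,Y)\bigr)=g_V(D^V_WX,Y)+g_V(X,D^V_WY)+2\,C_V(D^V_WV,X,Y),$$ with $g_y(u,v)=\frac12\frac{\partial^2}{\partial s\,\partial t}F^2(y+su+tv)\big|_{0}$ and $C_y(u,v,w)=\frac14\frac{\partial^3}{\partial r\,\partial s\,\partial t}F^2(y+ru+sv+tw)\big|_{0}$; it coincides with $\nabla$ if $D^V=\nabla$ for all $V$. -/

import Mathlib

open scoped Manifold ContDiff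
open Bundle VectorField

noncomputable section

namespace FinslerLie

/-- A `C^∞` Lie group over `ℝ` is in particular of the class for which Mathlib equips the tangent
space at the identity with its Lie algebra structure. -/
instance instLieGroupMinSmoothness {E : Type*} [NormedAddCommGroup E] [NormedSpace ℝ E]
    {H : Type*} [TopologicalSpace H] {I : ModelWithCorners ℝ E H}
    {G : Type*} [TopologicalSpace G] [ChartedSpace H G] [Group G] [LieGroup I ∞ G] :
    LieGroup I (minSmoothness ℝ 3) G :=
  LieGroup.of_le (n := ∞) (by
    rw [minSmoothness_of_isRCLikeNormedField]
    exact (ENat.LEInfty.out : (3 : WithTop ℕ∞) ≤ ∞))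

section Manifold

variable {E : Type*} [NormedAddCommGroup E] [NormedSpace ℝ E]
  {H : Type*} [TopologicalSpace H] (I : ModelWithCorners ℝ E H)
  (M : Type*) [TopologicalSpace M] [ChartedSpace H M]

/-- Smooth Riemannian metrics on the manifold `M`. -/
abbrev SmoothMetric [IsManifold I ∞ M] : Type _ :=
  ContMDiffRiemannianMetric I ∞ E (TangentSpace I : M → Type _)

/-- Real functions on the tangent bundle, such as Finsler metrics. -/
abbrev TangentFunction : Type _ := (x : M) → TangentSpace I x → ℝ

variable {I M}

/-- The torsion-free affine connection `cov` compatible with `g` (recall that `cov Y x (X x)` stands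
for `(∇_X Y)(x)`). -/
structure IsLeviCivita [FiniteDimensional ℝ E] [CompleteSpace E] [IsManifold I ∞ M]
    (g : SmoothMetric I M)
    (cov : CovariantDerivative I E (TangentSpace I : M → Type _)) : Prop where
  torsion_free : cov.torsion = 0
  metric : ∀ (x : M) (w : TangentSpace I x) (X Y : (p : M) → TangentSpace I p),
    MDiffAt (T% X) x → MDiffAt (T% Y) x →
      d% (fun p ↦ g.inner p (X p) (Y p)) x w =
        g.inner x (cov X x w) (Y x) + g.inner x (X x) (cov Y x w)

/-- The `(α,β)`-metric `F = (α + β)² / α`, where `α(v) = √g(v,v)` and `β(v) = g(X, v)`. -/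
def squareMetric [IsManifold I ∞ M] (g : SmoothMetric I M) (X : (p : M) → TangentSpace I p) :
    TangentFunction I M :=
  fun x v ↦ (√(g.inner x v v) + g.inner x (X x) v) ^ 2 / √(g.inner x v v)

/-- A metric `F` on the tangent bundle is Riemannian if it is the norm of a smooth Riemannian
metric. -/
def IsRiemannian [IsManifold I ∞ M] (F : TangentFunction I M) : Prop :=
  ∃ h : SmoothMetric I M, ∀ (x : M) (v : TangentSpace I x), F x v = √(h.inner x v v)

/-- The fundamental tensor `g_y(u,v) = ½ ∂²/∂s∂t F²(y + su + tv)` at `s = t = 0`. -/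
def fundamentalTensor (F : TangentFunction I M) (x : M) (y u v : TangentSpace I x) : ℝ :=
  (1 / 2) * deriv (fun s : ℝ ↦ deriv (fun t : ℝ ↦ F x (y + s • u + t • v) ^ 2) 0) 0

/-- The Cartan tensor `C_y(u,v,w) = ¼ ∂³/∂r∂s∂t F²(y + ru + sv + tw)` at `r = s = t = 0`. -/
def cartanTensor (F : TangentFunction I M) (x : M) (y u v w : TangentSpace I x) : ℝ :=
  (1 / 4) * deriv (fun r : ℝ ↦ deriv (fun s : ℝ ↦ deriv (fun t : ℝ ↦
    F x (y + r • u + s • v + t • w) ^ 2) 0) 0) 0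

/-- `D` is the Chern connection of the Finsler metric `F`: the linear connection on the pullback of
`TM` to the slit tangent bundle that is torsion-free and almost compatible with the fundamental
tensor. As torsion-freeness leaves only the horizontal part, such a connection is a family of
covariant derivatives indexed by nonzero reference vectors: `D x y X w` is the derivative at `x` of
the vector field `X` in the direction `w` with reference vector `y`, that is,
`w(Xⁱ) + Γⁱⱼₖ(x,y) Xʲ wᵏ` in coordinates. Almost compatibility,
`dg_ij - g_kj ω_i^k - g_ik ω_j^k = 2 C_ijs (dyˢ + Nˢ_k dxᵏ)` with `Nˢ_k = Γˢⱼₖ yʲ`,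
is stated along an arbitrary field `V` of reference vectors. -/
structure IsChernConnection [IsManifold I ∞ M] (F : TangentFunction I M)
    (D : (x : M) → TangentSpace I x → ((p : M) → TangentSpace I p) →
      TangentSpace I x →L[ℝ] TangentSpace I x) : Prop where
  add : ∀ (x : M) (y : TangentSpace I x) (X Y : (p : M) → TangentSpace I p), y ≠ 0 →
    MDiffAt (T% X) x → MDiffAt (T% Y) x → D x y (X + Y) = D x y X + D x y Y
  leibniz : ∀ (x : M) (y : TangentSpace I x) (f : M → ℝ) (X : (p : M) → TangentSpace I p), y ≠ 0 →
    MDiffAt (T% X) x → MDiffAt f x →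
      ∀ w : TangentSpace I x, D x y (f • X) w = f x • D x y X w + (d% f x w) • X x
  torsion_free : ∀ (x : M) (y : TangentSpace I x) (X Y : (p : M) → TangentSpace I p), y ≠ 0 →
    MDiffAt (T% X) x → MDiffAt (T% Y) x →
      D x y Y (X x) - D x y X (Y x) = mlieBracket I X Y x
  almost_metric : ∀ (x : M) (w : TangentSpace I x) (V X Y : (p : M) → TangentSpace I p), V x ≠ 0 →
    MDiffAt (T% V) x → MDiffAt (T% X) x → MDiffAt (T% Y) x →
      d% (fun p ↦ fundamentalTensor F p (V p) (X p) (Y p)) x w =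
        fundamentalTensor F x (V x) (D x (V x) X w) (Y x) +
          fundamentalTensor F x (V x) (X x) (D x (V x) Y w) +
          2 * cartanTensor F x (V x) (D x (V x) V w) (X x) (Y x)

/-- The Chern connection of `F` coincides with the Levi-Civita connection of `g`. -/
def ChernEqLeviCivita [FiniteDimensional ℝ E] [CompleteSpace E] [IsManifold I ∞ M]
    (F : TangentFunction I M) (g : SmoothMetric I M) : Prop :=
  ∃ cov : CovariantDerivative I E (TangentSpace I : M → Type _),
    IsLeviCivita g cov ∧ IsChernConnection F (fun x _ X ↦ cov X x)

end Manifold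

section Group

variable {E : Type*} [NormedAddCommGroup E] [NormedSpace ℝ E]
  {H : Type*} [TopologicalSpace H] {I : ModelWithCorners ℝ E H}
  {G : Type*} [TopologicalSpace G] [ChartedSpace H G] [Group G]

/-- Invariance of a Riemannian metric under all left translations. -/
def IsLeftInvariantMetric [IsManifold I ∞ G] (g : SmoothMetric I G) : Prop :=
  ∀ (a x : G) (v w : TangentSpace I x),
    g.inner (a * x) (mfderiv% (a * ·) x v) (mfderiv% (a * ·) x w) = g.inner x v w

/-- Invariance of a vector field under all left translations. -/
def IsLeftInvariantField (X : (p : G) → TangentSpace I p) : Prop :=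
  ∀ a x : G, X (a * x) = mfderiv% (a * ·) x (X x)

/-- `F` is a left invariant metric `(α + β)² / α` on the Lie group `G`: `α` is induced by a left
invariant Riemannian metric `g`, `β` is dual to a left invariant vector field `X` with
`g(X,X) < 1`, and the Chern connection of `F` coincides with the Levi-Civita connection of `g`. -/
def IsLeftInvariantSquareMetric [FiniteDimensional ℝ E] [CompleteSpace E] [IsManifold I ∞ G]
    (F : TangentFunction I G) : Prop :=
  ∃ (g : SmoothMetric I G) (X : (p : G) → TangentSpace I p),
    IsLeftInvariantMetric g ∧ IsLeftInvariantField X ∧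
    (∀ x : G, g.inner x (X x) (X x) < 1) ∧
    F = squareMetric g X ∧ ChernEqLeviCivita F g

end Group

end FinslerLie

end

/-! For a left invariant field `V ≠ 0`, both `g(V,V)` and `g(X,V)` are constant. Metric
compatibility then gives `∇_w V ⟂ V`, and `g_V(V,V)`, which equals `F²(V)`, is constant too. Put all
three fields equal to `V` in almost compatibility: the Cartan term vanishes by homogeneity and the
rest is the derivative of `F²` at `V` along `∇_w V`. For a direction `u ⟂ V` this derivative is a
positive multiple of `g(X,u)`, so `g(X, ∇_w V) = 0` (`inner_cov_eq_zero`). Since the torsion is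
zero, `X` is orthogonal to all brackets (`inner_bracket_eq_zero`). A semisimple algebra is perfect
(`derived_eq_top_of_isKilling`), so `X = 0` and `F = α`. -/

namespace FinslerLie

/-! ### Euler identities for functions homogeneous of degree two -/

section Homogeneous

open Filter Topology

/-- The difference quotient at `0` is `h` itself. Continuity is enough, so `C²` regularity along one
line suffices below, even for the third-order identity. -/
lemma hasDerivAt_id_mul_of_continuousAt {h : ℝ → ℝ} (hh : ContinuousAt h 0) :
    HasDerivAt (fun r ↦ r * h r) (h 0) 0 := by
  rw [hasDerivAt_iff_tendsto_slope]
  refine (hh.tendsto.mono_left nhdsWithin_le_nhds).congr' ?_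
  filter_upwards [self_mem_nhdsWithin] with r hr
  have hr : r ≠ 0 := hr
  simp [slope_def_field, hr]

variable {V : Type*} [AddCommGroup V] [Module ℝ V] {f : V → ℝ}

/-- Positive homogeneity of degree two, restricted to the plane spanned by `y` and `u`. -/
lemma eventually_homogeneous_plane
    (hf : ∀ (c : ℝ) (v : V), 0 < c → f (c • v) = c ^ 2 * f v) (y u : V) {a : ℝ} (ha : 0 < a)
    (r : ℝ) :
    (fun t ↦ f ((a + t) • y + r • u)) =ᶠ[𝓝 (0 : ℝ)]
      fun t ↦ (a + t) ^ 2 * f (y + (r / (a + t)) • u) := by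
  have : ∀ᶠ t in 𝓝 (0 : ℝ), 0 < a + t :=
    (continuous_const.add continuous_id).continuousAt.eventually_const_lt (by simpa using ha)
  filter_upwards [this] with t ht
  rw [← hf _ _ ht, smul_add, smul_smul, mul_div_cancel₀ _ ht.ne']

lemma hasDerivAt_sq_mul_comp_div {q : ℝ → ℝ} {a r q' : ℝ} (ha : a ≠ 0)
    (hq : HasDerivAt q q' (r / a)) :
    HasDerivAt (fun t ↦ (a + t) ^ 2 * q (r / (a + t))) (2 * a * q (r / a) - r * q') 0 := by
  have h1 : HasDerivAt (fun t : ℝ ↦ a + t) 1 0 := (hasDerivAt_id _).const_add a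
  have h2 : HasDerivAt (fun t : ℝ ↦ r / (a + t)) (-r / a ^ 2) 0 := by
    simpa using (hasDerivAt_const (0 : ℝ) r).fun_div h1 (by simpa using ha)
  have h3 : HasDerivAt (fun t : ℝ ↦ q (r / (a + t))) (q' * (-r / a ^ 2)) 0 :=
    HasDerivAt.comp (h₂ := q) (0 : ℝ) (by simpa using hq) h2
  refine ((h1.fun_pow 2).fun_mul h3).congr_deriv ?_
  simp
  field_simp
  ring

variable (hf : ∀ (c : ℝ) (v : V), 0 < c → f (c • v) = c ^ 2 * f v) {y u : V}
  (hq : ContDiffAt ℝ 2 (fun s : ℝ ↦ f (y + s • u)) 0)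
include hf

/-- With `q s = f (y + s • u)`, homogeneity gives `f (a • y + r • u) = a² q(r/a)` for `a > 0`;
differentiate in `a`. -/
lemma deriv_radial {a r : ℝ} (ha : 0 < a)
    (hq : DifferentiableAt ℝ (fun s : ℝ ↦ f (y + s • u)) (r / a)) :
    deriv (fun t : ℝ ↦ f ((a + t) • y + r • u)) 0 =
      2 * a * f (y + (r / a) • u) - r * deriv (fun s : ℝ ↦ f (y + s • u)) (r / a) := by
  rw [(eventually_homogeneous_plane hf y u ha r).deriv_eq]
  exact (hasDerivAt_sq_mul_comp_div (q := fun s ↦ f (y + s • u)) ha.ne' hq.hasDerivAt).deriv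

include hq

/-- The inner derivative is `2q - s q'`. The two orders of differentiation are computed separately,
so symmetry of second derivatives is not needed. -/
lemma deriv_deriv_self_right :
    deriv (fun s : ℝ ↦ deriv (fun t : ℝ ↦ f (y + s • u + t • y)) 0) 0 =
      deriv (fun s : ℝ ↦ f (y + s • u)) 0 := by
  set q : ℝ → ℝ := fun s : ℝ ↦ f (y + s • u) with hqdef
  have hdiff : ∀ᶠ s in 𝓝 (0 : ℝ), DifferentiableAt ℝ q s :=
    (hq.eventually (by simp)).mono fun s hs ↦ hs.differentiableAt (by simp)
  have hc : ContinuousAt (deriv q) 0 := (hq.derivWithin (m := 1) (by norm_num)).continuousAt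
  have key : (fun s : ℝ ↦ deriv (fun t : ℝ ↦ f (y + s • u + t • y)) 0) =ᶠ[𝓝 0]
      fun s ↦ 2 * q s - s * deriv q s := by
    filter_upwards [hdiff] with s hs
    have := deriv_radial (a := 1) (r := s) hf one_pos (by simpa using hs)
    simp only [div_one, mul_one] at this
    rw [← this]
    congr 1; ext t; congr 1; module
  rw [key.deriv_eq]
  refine ((hdiff.self_of_nhds.hasDerivAt.const_mul 2).fun_sub
    (hasDerivAt_id_mul_of_continuousAt hc)).deriv.trans ?_
  ring

/-- The first derivative along `u` is homogeneous of degree one, so at `(1 + s) • y` it is `(1 + s)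
q'(0)`. -/
lemma deriv_deriv_self_left :
    deriv (fun s : ℝ ↦ deriv (fun t : ℝ ↦ f (y + s • y + t • u)) 0) 0 =
      deriv (fun s : ℝ ↦ f (y + s • u)) 0 := by
  set q : ℝ → ℝ := fun s : ℝ ↦ f (y + s • u) with hqdef
  have hd : DifferentiableAt ℝ q 0 := hq.differentiableAt (by simp)
  have hpos : ∀ᶠ s in 𝓝 (0 : ℝ), 0 < 1 + s :=
    (continuous_const.add continuous_id).continuousAt.eventually_const_lt (by simp)
  have key : (fun s : ℝ ↦ deriv (fun t : ℝ ↦ f (y + s • y + t • u)) 0) =ᶠ[𝓝 0]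
      fun s ↦ (1 + s) * deriv q 0 := by
    filter_upwards [hpos] with s hs
    have : (fun t : ℝ ↦ f (y + s • y + t • u)) = fun t ↦ (1 + s) ^ 2 * q (t / (1 + s)) := by
      ext t
      rw [hqdef, ← hf _ _ hs, smul_add, smul_smul, mul_div_cancel₀ _ hs.ne']
      congr 1; module
    rw [this]
    have h2 : HasDerivAt (fun t : ℝ ↦ t / (1 + s)) (1 / (1 + s)) 0 :=
      (hasDerivAt_id _).div_const _
    have h3 : HasDerivAt (fun t : ℝ ↦ q (t / (1 + s))) (deriv q 0 * (1 / (1 + s))) 0 :=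
      HasDerivAt.comp (h₂ := q) (0 : ℝ) (by simpa using hd.hasDerivAt) h2
    rw [(h3.const_mul _).deriv]
    field_simp
  rw [key.deriv_eq]
  simp

/-- The Hessian at `y + r • u` on `(y, y)` is `2q - 2r q' + r² q''`, whose derivative at `r = 0` is
`2q' - 2q' = 0`. Hence `C_y(u,y,y) = 0`. -/
lemma deriv_deriv_deriv_self_self :
    deriv (fun r : ℝ ↦ deriv (fun s : ℝ ↦ deriv (fun t : ℝ ↦
      f (y + r • u + s • y + t • y)) 0) 0) 0 = 0 := by
  set q : ℝ → ℝ := fun s : ℝ ↦ f (y + s • u) with hqdef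
  have hq1 : ContDiffAt ℝ 1 (deriv q) 0 := hq.derivWithin (m := 1) (by norm_num)
  have hdiff : ∀ᶠ s in 𝓝 (0 : ℝ), DifferentiableAt ℝ q s :=
    (hq.eventually (by simp)).mono fun s hs ↦ hs.differentiableAt (by simp)
  have hdiff1 : ∀ᶠ s in 𝓝 (0 : ℝ), DifferentiableAt ℝ (deriv q) s :=
    (hq1.eventually (by simp)).mono fun s hs ↦ hs.differentiableAt (by simp)
  have hc1 : ContinuousAt (deriv q) 0 := hq1.continuousAt
  have hc2 : ContinuousAt (deriv (deriv q)) 0 :=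
    (hq1.derivWithin (m := 0) (by norm_num)).continuousAt
  have key : (fun r : ℝ ↦ deriv (fun s : ℝ ↦ deriv (fun t : ℝ ↦
      f (y + r • u + s • y + t • y)) 0) 0) =ᶠ[𝓝 0]
      fun r ↦ 2 * q r + r * (-2 * deriv q r + r * deriv (deriv q) r) := by
    filter_upwards [hdiff.eventually_nhds, hdiff1] with r hr hr1
    have hdiv : ContinuousAt (fun s : ℝ ↦ r / (1 + s)) 0 := by
      refine continuousAt_const.div (by fun_prop) (by simp)
    have hr' : ∀ᶠ s in 𝓝 (0 : ℝ), DifferentiableAt ℝ q (r / (1 + s)) :=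
      hdiv.eventually (by simpa using hr)
    have hpos : ∀ᶠ s in 𝓝 (0 : ℝ), 0 < 1 + s :=
      (continuous_const.add continuous_id).continuousAt.eventually_const_lt (by simp)
    have inner : (fun s : ℝ ↦ deriv (fun t : ℝ ↦ f (y + r • u + s • y + t • y)) 0) =ᶠ[𝓝 0]
        fun s ↦ 2 * (1 + s) * q (r / (1 + s)) - r * deriv q (r / (1 + s)) := by
      filter_upwards [hr', hpos] with s hs hs0
      rw [← deriv_radial hf hs0 hs]
      congr 1; ext t; congr 1; module
    rw [inner.deriv_eq]
    have h1 : HasDerivAt (fun t : ℝ ↦ 1 + t) 1 0 := (hasDerivAt_id _).const_add 1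
    have h2 : HasDerivAt (fun t : ℝ ↦ r / (1 + t)) (-r) 0 := by
      simpa using (hasDerivAt_const (0 : ℝ) r).fun_div h1 (by simp)
    have h3 : HasDerivAt (fun t : ℝ ↦ q (r / (1 + t))) (deriv q r * -r) 0 :=
      HasDerivAt.comp (h₂ := q) (0 : ℝ) (by simpa using hr.self_of_nhds.hasDerivAt) h2
    have h4 : HasDerivAt (fun t : ℝ ↦ deriv q (r / (1 + t))) (deriv (deriv q) r * -r) 0 :=
      HasDerivAt.comp (h₂ := (deriv q)) (0 : ℝ) (by simpa using hr1.hasDerivAt) h2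
    refine (((h1.const_mul 2).fun_mul h3).fun_sub (h4.const_mul r)).deriv.trans ?_
    simp
    ring
  rw [key.deriv_eq]
  refine ((hdiff.self_of_nhds.hasDerivAt.const_mul 2).fun_add
    (hasDerivAt_id_mul_of_continuousAt (h := fun r ↦ -2 * deriv q r + r * deriv (deriv q) r)
      ((continuousAt_const.mul hc1).add (continuousAt_id.mul hc2)))).deriv.trans ?_
  simp

end Homogeneous

/-! ### Semisimple Lie algebras are perfect -/

section Perfect

/-- The Killing complement `J` of `[L,L]` satisfies `[J,J] ≤ [L,L] ⊓ J = ⊥`. It is thus an abelian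
ideal, hence zero. -/
lemma derived_eq_top_of_isKilling (K L : Type*) [Field K] [LieRing L] [LieAlgebra K L]
    [Module.Finite K L] [LieAlgebra.IsKilling K L] :
    ⁅(⊤ : LieIdeal K L), (⊤ : LieIdeal K L)⁆ = ⊤ := by
  set I : LieIdeal K L := ⁅(⊤ : LieIdeal K L), (⊤ : LieIdeal K L)⁆ with hI
  have hc := LieIdeal.isCompl_killingCompl I
  have hJ : IsLieAbelian (LieIdeal.killingCompl K L I) := by
    rw [LieSubmodule.lie_abelian_iff_lie_self_eq_bot, eq_bot_iff, ← hc.inf_eq_bot]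
    exact le_inf (LieSubmodule.mono_lie le_top le_top) (LieSubmodule.lie_le_left _ _)
  have := LieAlgebra.IsKilling.ideal_eq_bot_of_isLieAbelian (LieIdeal.killingCompl K L I)
  simpa [this] using hc.sup_eq_top

end Perfect

/-! ### The metric `(α + β)² / α` and its derivatives -/

section SquareMetric

variable {E : Type*} [NormedAddCommGroup E] [NormedSpace ℝ E]
  {H : Type*} [TopologicalSpace H] {I : ModelWithCorners ℝ E H}
  {M : Type*} [TopologicalSpace M] [ChartedSpace H M] [IsManifold I ∞ M]
  (g : SmoothMetric I M) (X : (p : M) → TangentSpace I p)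

lemma squareMetric_smul {c : ℝ} (hc : 0 < c) (x : M) (v : TangentSpace I x) :
    squareMetric g X x (c • v) = c * squareMetric g X x v := by
  have h : √(g.inner x (c • v) (c • v)) = c * √(g.inner x v v) := by
    rw [map_smul, map_smul, _root_.smul_apply, smul_eq_mul, smul_eq_mul, ← mul_assoc,
      Real.sqrt_mul (by positivity), Real.sqrt_mul_self hc.le]
  rw [squareMetric, squareMetric, h, map_smul, smul_eq_mul]
  rw [← mul_add, mul_pow, sq c, mul_assoc c c, mul_div_mul_left _ _ hc.ne', mul_div_assoc]

lemma squareMetric_sq_smul (x : M) (c : ℝ) (v : TangentSpace I x) (hc : 0 < c) :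
    squareMetric g X x (c • v) ^ 2 = c ^ 2 * squareMetric g X x v ^ 2 := by
  rw [squareMetric_smul g X hc, mul_pow]

lemma sqrt_inner_self_add_inner_pos {x : M} (hX : g.inner x (X x) (X x) < 1)
    {y : TangentSpace I x} (hy : y ≠ 0) :
    0 < √(g.inner x y y) + g.inner x (X x) y := by
  have hn := g.pos x y hy
  set n := g.inner x y y with hndef
  set b := g.inner x (X x) y with hbdef
  -- Cauchy–Schwarz, from the component of `X` orthogonal to `y`.
  have hnonneg : 0 ≤ g.inner x (X x - (b / n) • y) (X x - (b / n) • y) := by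
    by_cases h : X x - (b / n) • y = 0
    · simp [h]
    · exact (g.pos x _ h).le
  have hexp : g.inner x (X x - (b / n) • y) (X x - (b / n) • y) =
      g.inner x (X x) (X x) - b ^ 2 / n := by
    simp only [map_sub, map_smul, _root_.sub_apply, _root_.smul_apply,
      smul_eq_mul, g.symm x y (X x), ← hbdef, ← hndef]
    field_simp
    ring
  have hlt : b ^ 2 < n := by
    rw [← div_lt_one hn]
    linarith
  linarith [Real.neg_sqrt_lt_of_sq_lt hlt]

lemma inner_add_smul_self (x : M) (y u : TangentSpace I x) (s : ℝ) :
    g.inner x (y + s • u) (y + s • u) =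
      g.inner x y y + 2 * s * g.inner x y u + s ^ 2 * g.inner x u u := by
  simp only [map_add, map_smul, _root_.add_apply, _root_.smul_apply,
    smul_eq_mul, g.symm x u y]
  ring

lemma squareMetric_add_smul (x : M) (y u : TangentSpace I x) (s : ℝ) :
    squareMetric g X x (y + s • u) =
      (√(g.inner x y y + 2 * s * g.inner x y u + s ^ 2 * g.inner x u u) +
        (g.inner x (X x) y + s * g.inner x (X x) u)) ^ 2 /
      √(g.inner x y y + 2 * s * g.inner x y u + s ^ 2 * g.inner x u u) := by
  rw [squareMetric, inner_add_smul_self, map_add, map_smul, smul_eq_mul]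

lemma contDiffAt_squareMetric_sq {x : M} {y : TangentSpace I x} (hy : y ≠ 0)
    (u : TangentSpace I x) {n : WithTop ℕ∞} :
    ContDiffAt ℝ n (fun s : ℝ ↦ squareMetric g X x (y + s • u) ^ 2) 0 := by
  have hn := g.pos x y hy
  simp only [squareMetric_add_smul]
  generalize g.inner x y y = a at hn ⊢
  generalize g.inner x y u = c
  generalize g.inner x u u = d
  generalize g.inner x (X x) y = b
  generalize g.inner x (X x) u = e
  have hN : ContDiffAt ℝ n (fun s : ℝ ↦ √(a + 2 * s * c + s ^ 2 * d)) 0 :=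
    ContDiffAt.sqrt (by fun_prop) (by simpa using hn.ne')
  refine (((hN.add (by fun_prop)).pow 2).div hN ?_).pow 2
  simpa using (Real.sqrt_pos.2 hn).ne'

/-- For `u ⟂ y`, `α` is stationary, so only `β` varies in `F² = (α + β)⁴ / α²`. -/
lemma deriv_squareMetric_sq {x : M} {y u : TangentSpace I x} (hy : y ≠ 0)
    (hyu : g.inner x y u = 0) :
    deriv (fun s : ℝ ↦ squareMetric g X x (y + s • u) ^ 2) 0 =
      4 * (√(g.inner x y y) + g.inner x (X x) y) ^ 3 / g.inner x y y * g.inner x (X x) u := by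
  have hn := g.pos x y hy
  simp only [squareMetric_add_smul, hyu]
  generalize g.inner x y y = a at hn ⊢
  generalize g.inner x (X x) y = b
  generalize g.inner x u u = d
  generalize g.inner x (X x) u = e
  have hN : HasDerivAt (fun s : ℝ ↦ √(a + 2 * s * 0 + s ^ 2 * d)) 0 0 := by
    have h0 : HasDerivAt (fun s : ℝ ↦ a + 2 * s * 0 + s ^ 2 * d) 0 0 := by
      simpa using ((hasDerivAt_pow 2 (0 : ℝ)).mul_const d).const_add a
    simpa using h0.sqrt (by simpa using hn.ne')
  have hL : HasDerivAt (fun s : ℝ ↦ b + s * e) e 0 := by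
    simpa using ((hasDerivAt_id (0 : ℝ)).mul_const e).const_add b
  have hr := Real.sqrt_pos.2 hn
  have := (((hN.fun_add hL).fun_pow 2).fun_div hN (by simpa using hr.ne')).fun_pow 2
  refine this.deriv.trans ?_
  obtain ⟨r, hr0, rfl⟩ : ∃ r : ℝ, 0 < r ∧ a = r ^ 2 := ⟨√a, hr, (Real.sq_sqrt hn.le).symm⟩
  simp [Real.sqrt_sq hr0.le]
  field_simp
  ring

lemma squareMetric_eq_of_inner_eq {x x' : M} {v : TangentSpace I x} {v' : TangentSpace I x'}
    (h : g.inner x v v = g.inner x' v' v') (h' : g.inner x (X x) v = g.inner x' (X x') v') :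
    squareMetric g X x v = squareMetric g X x' v' := by
  rw [squareMetric, squareMetric, h, h']

lemma fundamentalTensor_squareMetric_self_eq {x x' : M} {v : TangentSpace I x}
    {v' : TangentSpace I x'} (h : g.inner x v v = g.inner x' v' v')
    (h' : g.inner x (X x) v = g.inner x' (X x') v') :
    fundamentalTensor (squareMetric g X) x v v v =
      fundamentalTensor (squareMetric g X) x' v' v' v' := by
  have key (s t : ℝ) : squareMetric g X x (v + s • v + t • v) =
      squareMetric g X x' (v' + s • v' + t • v') := by
    apply squareMetric_eq_of_inner_eq <;>
      simp only [map_add, map_smul, _root_.add_apply, _root_.smul_apply, h, h']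
  simp only [fundamentalTensor, key]

/-- If `V` has constant `g`-length and constant inner product with `X`, and the Levi-Civita
connection of `g` is the Chern connection of `(α + β)² / α`, then `∇V` is orthogonal to `X`. -/
lemma inner_cov_eq_zero [FiniteDimensional ℝ E] [CompleteSpace E]
    {cov : CovariantDerivative I E (TangentSpace I : M → Type _)} (hcov : IsLeviCivita g cov)
    (hchern : IsChernConnection (squareMetric g X) (fun x _ Y ↦ cov Y x))
    {V : (p : M) → TangentSpace I p} {x : M} (hV : MDiffAt (T% V) x) (hVx : V x ≠ 0)
    (hX : g.inner x (X x) (X x) < 1)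
    (hVV : ∀ p, g.inner p (V p) (V p) = g.inner x (V x) (V x))
    (hXV : ∀ p, g.inner p (X p) (V p) = g.inner x (X x) (V x)) (w : TangentSpace I x) :
    g.inner x (X x) (cov V x w) = 0 := by
  have h1 := hcov.metric x w V V hV hV
  have h2 := hchern.almost_metric x w V V V hVx hV hV hV
  rw [funext hVV, mvfderiv_const, g.symm x (cov V x w)] at h1
  have hperp : g.inner x (V x) (cov V x w) = 0 := by
    have : (0 : ℝ) = g.inner x (V x) (cov V x w) + g.inner x (V x) (cov V x w) := h1
    linarith
  have hconst : (fun p ↦ fundamentalTensor (squareMetric g X) p (V p) (V p) (V p)) =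
      fun _ ↦ fundamentalTensor (squareMetric g X) x (V x) (V x) (V x) :=
    funext fun p ↦ fundamentalTensor_squareMetric_self_eq g X (hVV p) (hXV p)
  rw [hconst, mvfderiv_const] at h2
  have hsm := contDiffAt_squareMetric_sq g X (n := 2) hVx (cov V x w)
  have hf := squareMetric_sq_smul g X x
  simp only [fundamentalTensor, cartanTensor] at h2
  -- Each fundamental-tensor term is half the derivative of `F²` along `cov V x w`; the Cartan term
  -- is zero.
  rw [deriv_deriv_self_right (f := fun v ↦ squareMetric g X x v ^ 2) hf hsm,
    deriv_deriv_self_left (f := fun v ↦ squareMetric g X x v ^ 2) hf hsm,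
    deriv_deriv_deriv_self_self (f := fun v ↦ squareMetric g X x v ^ 2) hf hsm,
    deriv_squareMetric_sq g X hVx hperp] at h2
  have hpos := sqrt_inner_self_add_inner_pos g X hX hVx
  have hn := g.pos x (V x) hVx
  have h3 : 0 = 4 * (√(g.inner x (V x) (V x)) + g.inner x (X x) (V x)) ^ 3 /
      g.inner x (V x) (V x) * g.inner x (X x) (cov V x w) := by
    refine h2.trans ?_
    ring
  exact (mul_eq_zero.1 h3.symm).resolve_left (by positivity)

lemma squareMetric_isRiemannian_of_eq_zero (hX : ∀ x, X x = 0) :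
    IsRiemannian (squareMetric g X) := by
  refine ⟨g, fun x v ↦ ?_⟩
  -- At `v = 0` this relies on `0 / 0 = 0`.
  rw [squareMetric, hX, map_zero, _root_.zero_apply, add_zero, sq, mul_self_div_self]

end SquareMetric

/-! ### Left invariant fields on the Lie group -/

section Group

variable {E : Type*} [NormedAddCommGroup E] [NormedSpace ℝ E]
  {H : Type*} [TopologicalSpace H] {I : ModelWithCorners ℝ E H}
  {G : Type*} [TopologicalSpace G] [ChartedSpace H G] [Group G]

lemma IsLeftInvariantField.eq_mulInvariantVectorField {X : (p : G) → TangentSpace I p}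
    (hX : IsLeftInvariantField X) (p : G) : X p = mulInvariantVectorField (I := I) (X 1) p := by
  -- `p * 1 = p` is not definitional, so values at the two points are compared in the model space
  -- `E`.
  have h (q : G) (hq : q = p) : (show E from X p) = (show E from X q) := by rw [hq]
  exact (h (p * 1) (mul_one p)).trans (hX p 1)

variable [LieGroup I ∞ G]

lemma IsLeftInvariantMetric.inner_mulInvariantVectorField {g : SmoothMetric I G}
    (hg : IsLeftInvariantMetric g) (v w : GroupLieAlgebra I G) (p : G) :
    g.inner p (mulInvariantVectorField v p) (mulInvariantVectorField w p) = g.inner 1 v w := by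
  have h (q : G) (hq : q = p) (a b : E) :
      g.inner p (show TangentSpace I p from a) (show TangentSpace I p from b) =
        g.inner q (show TangentSpace I q from a) (show TangentSpace I q from b) := by
    subst hq; rfl
  exact (h (p * 1) (mul_one p) _ _).trans (hg p 1 v w)

/-- A left invariant field `X` whose metric `(α + β)² / α` has the Levi-Civita connection as its
Chern connection is orthogonal to the derived algebra. -/
lemma inner_bracket_eq_zero [FiniteDimensional ℝ E] [CompleteSpace E] {g : SmoothMetric I G}
    (hg : IsLeftInvariantMetric g) {X : (p : G) → TangentSpace I p} (hX : IsLeftInvariantField X)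
    (hX1 : ∀ x : G, g.inner x (X x) (X x) < 1) (h : ChernEqLeviCivita (squareMetric g X) g)
    (v w : GroupLieAlgebra I G) : g.inner 1 (X 1) ⁅v, w⁆ = 0 := by
  obtain ⟨cov, hcov, hchern⟩ := h
  have hone (v : GroupLieAlgebra I G) : mulInvariantVectorField v (1 : G) = v := by
    have : (fun x : G ↦ 1 * x) = id := funext one_mul
    rw [mulInvariantVectorField, this, mfderiv_id]
    rfl
  have hcov0 {v : GroupLieAlgebra I G} (hv : v ≠ 0) (w : TangentSpace I (1 : G)) :
      g.inner 1 (X 1) (cov (mulInvariantVectorField v) 1 w) = 0 := by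
    refine inner_cov_eq_zero g X hcov hchern (mdifferentiableAt_mulInvariantVectorField v)
      (by rwa [hone]) (hX1 1) (fun p ↦ ?_) (fun p ↦ ?_) w
    · rw [hg.inner_mulInvariantVectorField, hone]
    · rw [hX.eq_mulInvariantVectorField p, hg.inner_mulInvariantVectorField, hone]
  -- Zero is no admissible reference vector, but then the bracket is zero.
  by_cases hv : v = 0
  · simp [hv]
  by_cases hw : w = 0
  · simp [hw]
  have htor := cov.torsion_apply (mdifferentiableAt_mulInvariantVectorField v (g := (1 : G)))
    (mdifferentiableAt_mulInvariantVectorField w)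
  rw [hcov.torsion_free] at htor
  rw [GroupLieAlgebra.bracket_def, ← sub_eq_zero.1 htor.symm, map_sub, hcov0 hw, hcov0 hv, sub_zero]

lemma eq_zero_of_chernEqLeviCivita [FiniteDimensional ℝ E] [CompleteSpace E]
    [LieAlgebra.HasTrivialRadical ℝ (GroupLieAlgebra I G)] {g : SmoothMetric I G}
    (hg : IsLeftInvariantMetric g) {X : (p : G) → TangentSpace I p} (hX : IsLeftInvariantField X)
    (hX1 : ∀ x : G, g.inner x (X x) (X x) < 1) (h : ChernEqLeviCivita (squareMetric g X) g)
    (p : G) : X p = 0 := by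
  have : Module.Finite ℝ (GroupLieAlgebra I G) := inferInstanceAs (Module.Finite ℝ E)
  have hle : (⊤ : Submodule ℝ (GroupLieAlgebra I G)) ≤
      LinearMap.ker (g.inner 1 (X 1)).toLinearMap := by
    -- Trivial radical yields a nondegenerate Killing form by instance (Cartan's criterion).
    rw [← LieSubmodule.top_toSubmodule (R := ℝ) (L := GroupLieAlgebra I G),
      ← derived_eq_top_of_isKilling ℝ (GroupLieAlgebra I G),
      LieSubmodule.lieIdeal_oper_eq_linear_span', Submodule.span_le]
    rintro _ ⟨v, -, w, -, rfl⟩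
    exact inner_bracket_eq_zero hg hX hX1 h v w
  have hX0 : X 1 = 0 := by
    by_contra hne
    exact (g.pos 1 (X 1) hne).ne' (hle (Submodule.mem_top (x := X 1)))
  rw [hX.eq_mulInvariantVectorField p, hX0, mulInvariantVectorField]
  exact map_zero _

end Group

end FinslerLie

theorem mainTheorem5 {E : Type*} [NormedAddCommGroup E] [NormedSpace ℝ E] [FiniteDimensional ℝ E]
    [CompleteSpace E] {H : Type*} [TopologicalSpace H] (I : ModelWithCorners ℝ E H) [I.Boundaryless]
    (G : Type*) [TopologicalSpace G] [ChartedSpace H G] [Group G] [LieGroup I ∞ G]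
    [ConnectedSpace G] [LieAlgebra.HasTrivialRadical ℝ (GroupLieAlgebra I G)] :
    ¬ ∃ F : FinslerLie.TangentFunction I G,
      FinslerLie.IsLeftInvariantSquareMetric F ∧ ¬ FinslerLie.IsRiemannian F := by
  rintro ⟨F, ⟨g, X, hg, hX, hX1, rfl, h⟩, hF⟩
  exact hF (FinslerLie.squareMetric_isRiemannian_of_eq_zero g X
    (FinslerLie.eq_zero_of_chernEqLeviCivita hg hX hX1 h))
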